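/- **Theorem (asymptotic normality of the QMLE with privatized explanatory variables).** *Protocol.* Let $\mathcal X\subset\mathbb R^k$ and $\mathcal Y\subset\mathbb R$ be measurable, and let $\epsilon>0$, $l_X<u_X$, $l_Y<u_Y$ be real numbers. Put $C_\eta=\frac{e^\eta+1}{e^\eta-1}$ for $\eta>0$. For an interval $[l,u]$ let $t_{l,u}(v)=\max\{l,\min\{v,u\}\}$ be truncation to $[l,u]$, and let the bit flip with budget $\eta$ release, from $v\in[l,u]$, one of the two values $z_\pm$ with probability $$\mathrm{bitf}_{\eta}^{l,u}(z_\pm\mid v)=\frac12\pm\frac{v-\frac{u+l}{2}}{(u-l)\,C_\eta}.$$ Put $\eta=\epsilon/(k+1)$. User $i$ holds $\mathbf X_i\sim F_{\mathbf X}$ (a distribution on $\mathcal X$) and $Y_i\mid \mathbf X_i\sim F(\cdot\mid \mathbf X_i)$ (on $\mathcal Y$), independently over users. The user submits $k+1$ bits: $\mathbf z^{(\mathbf X)}\in\{-1,+1\}^k$, drawn coordinatewise by the bit flip, with probability $Q_{\mathbf X}(\mathbf z^{(\mathbf X)}\mid\mathbf x)=\prod_{j=1}^k \mathrm{bitf}_{\eta}^{l_X,u_X}(z^{(\mathbf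 X)}_j\mid t_{l_X,u_X}(x_j))$ (for $l_X=-1,u_X=1$ each factor is $\frac12+\frac{t(x_j)z_j}{2C_\eta}$), and, independently given the data, $z^{(Y)}\in\{0,1\}$, with probability $Q_Y(z^{(Y)}\mid y)=\mathrm{bitf}_{\eta}^{l_Y,u_Y}(z^{(Y)}\mid t_{l_Y,u_Y}(y))$. Let $P$ be the law of $(\mathbf z^{(\mathbf X)},z^{(Y)})$ on $\{-1,+1\}^k\times\{0,1\}$, i.e. $P(\mathbf z^{(\mathbf X)},z^{(Y)})=\int\!\!\int Q_{\mathbf X}(\mathbf z^{(\mathbf X)}\mid\mathbf x)Q_Y(z^{(Y)}\mid y)\,dF(y\mid\mathbf x)\,dF_{\mathbf X}(\mathbf x)$. We write $Pg$ for the expectation of $g$ under $P$. *Model.* The curator chooses a provisional distribution $\hat F_{\mathbf X}$ on $\mathcal X$ and conditional distributions $F_\beta(\cdot\mid\mathbf x)$ on $\mathcal Y$, $\beta\in\mathcal B$, where $\mathcal B\subset\mathbb R^d$ is compact. Let $p_\beta$ be the probability function on $\{-1,+1\}^k\times\{0,1\}$ obtained from the formula for $P$ by replacing $F_{\mathbf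 X},F$ with $\hat F_{\mathbf X},F_\beta$, and put $$\Lambda(\beta,\mathbf x)=\int Q_Y(1\mid y)\,dF_\beta(y\mid\mathbf x),\quad \hat p(\mathbf z)=\int Q_{\mathbf X}(\mathbf z\mid\mathbf x)\,d\hat F_{\mathbf X}(\mathbf x),\quad \Phi(\beta,\mathbf z)=\frac{\int\Lambda(\beta,\mathbf x)Q_{\mathbf X}(\mathbf z\mid\mathbf x)\,d\hat F_{\mathbf X}(\mathbf x)}{\hat p(\mathbf z)} .$$ Thus $p_\beta(\mathbf z,z)=\hat p(\mathbf z)\Phi(\beta,\mathbf z)^{z}(1-\Phi(\beta,\mathbf z))^{1-z}$. From i.i.d. submissions $(\mathbf z_i^{(\mathbf X)},z_i^{(Y)})\sim P$ the curator forms $$\ell(\beta;D_n)=\frac1n\sum_{i=1}^n\Big(\log\hat p(\mathbf z_i^{(\mathbf X)})+z_i^{(Y)}\log\Phi(\beta,\mathbf z_i^{(\mathbf X)})+(1-z_i^{(Y)})\log\big(1-\Phi(\beta,\mathbf z_i^{(\mathbf X)})\big)\Big),$$ and $\hat\beta_n$ is any (measurable) maximizer of $\ell(\cdot;D_n)$ over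 $\mathcal B$. Primes denote derivatives in $\beta$. *Assumptions.* For some measures $\mu$ on $\mathcal X$ and $\nu$ on $\mathcal Y$: 1. for every $\mathbf x$, $F(\cdot\mid\mathbf x)$ has a measurable density with respect to $\nu$; 2. $F_{\mathbf X}$ and $\hat F_{\mathbf X}$ have measurable densities with respect to $\mu$; 3. $F_\beta(\cdot\mid\mathbf x)$ has a density $f_\beta(y\mid\mathbf x)$ with respect to $\nu$ that is measurable in $y$ for all $\mathbf x,\beta$, and continuous in $\beta\in\mathcal B$ for all $\mathbf x,y$; 4. $\beta\mapsto P\log p_\beta$ has a unique maximizer $\beta^*$ over $\mathcal B$; 5. $\beta^*$ is interior to $\mathcal B$; 6. for every $\mathbf z$, $\Phi'(\beta,\mathbf z)$ exists and is a continuously differentiable function of $\beta$ in the interior of $\mathcal B$; 7. the absolute values of all entries of $\Phi''(\beta,\mathbf z)$ and $\Phi'(\beta,\mathbf z)\Phi'(\beta,\mathbf z)^\top$ are bounded, for all $\beta$ in the interior of $\mathcal B$, by $P$-integrable functions not depending on $\beta$; 8. $\mathbb E_P\big[\Phi'(\beta^*,\mathbf z^{(\mathbf X)})\Phi'(\beta^*,\mathbf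 z^{(\mathbf X)})^\top\big]$ is nonsingular; 9. $A(\beta^*)$ is nonsingular, where $$A(\beta)=P\,\frac{\partial^2\log p_\beta}{\partial\beta^2},\qquad B(\beta)=P\Big(\frac{\partial\log p_\beta}{\partial\beta}\Big)\Big(\frac{\partial\log p_\beta}{\partial\beta}\Big)^{\top}.$$ *Conclusion.* As $n\to\infty$, in distribution, $$\sqrt n\,(\hat\beta_n-\beta^*)\ \longrightarrow\ \mathcal N\big(0_d,\;A(\beta^*)^{-1}B(\beta^*)A(\beta^*)^{-1}\big).$$ -/

import Mathlib

open MeasureTheory ProbabilityTheory Filter Topology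
open scoped NNReal ENNReal

noncomputable section

namespace PrivateQMLE

/-- `C_ε = (e^ε + 1) / (e^ε - 1)`. -/
def flipConst (ε : ℝ) : ℝ := (Real.exp ε + 1) / (Real.exp ε - 1)

/-- The truncation `t` of a real number to `[l, u]` (for `l ≤ u`). -/
def trunc (l u v : ℝ) : ℝ := max l (min v u)

/-- The bit flip with budget `ε` on `[l, u]`: the probability that the input `v ∈ [l, u]` is
released as the bit `z`. The bit `true` stands for `z₊` and `false` for `z₋`. -/
def bitFlip (ε l u v : ℝ) (z : Bool) : ℝ :=
  if z then 1 / 2 + (v - (u + l) / 2) / ((u - l) * flipConst ε)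
  else 1 / 2 - (v - (u + l) / 2) / ((u - l) * flipConst ε)

/-- Public constants of the protocol: the total privacy budget `ε` of a user, the interval
`[lX, uX]` to which every coordinate of `X` is truncated, and the interval `[lY, uY]` to which
the response is truncated. -/
structure Protocol where
  ε : ℝ
  lX : ℝ
  uX : ℝ
  lY : ℝ
  uY : ℝ
  ε_pos : 0 < ε
  lX_lt_uX : lX < uX
  lY_lt_uY : lY < uY

/-- What a user submits: the `k` bits `z^(X)` (`true` is `+1`, `false` is `-1`) and the single
bit `z^(Y)` (`true` is `1`, `false` is `0`). -/
abbrev Obs (k : ℕ) : Type := (Fin k → Bool) × Bool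

section Model

variable {k d : ℕ} {𝒳 : Set (EuclideanSpace ℝ (Fin k))} {𝒴 : Set ℝ}

/-- The mechanism for the explanatory variables: `Q(z^(X) | x)`, the coordinatewise bit flip,
each coordinate with budget `ε / (k + 1)`. -/
def mechX (pr : Protocol) (zX : Fin k → Bool) (x : EuclideanSpace ℝ (Fin k)) : ℝ :=
  ∏ j, bitFlip (pr.ε / (k + 1)) pr.lX pr.uX (trunc pr.lX pr.uX (x j)) (zX j)

/-- The mechanism for the response: `Q(z^(Y) | t(y))`, the bit flip with budget `ε / (k + 1)`. -/
def mechY (k : ℕ) (pr : Protocol) (zY : Bool) (y : ℝ) : ℝ :=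
  bitFlip (pr.ε / (k + 1)) pr.lY pr.uY (trunc pr.lY pr.uY y) zY

/-- The joint probability of the submission `(z^(X), z^(Y))` when `X ∼ FX` and `Y | X = x ∼ G x`:
`∫∫ Q(z^(X) | x) Q(z^(Y) | t(y)) dG(y | x) dFX(x)`. -/
def obsProb (pr : Protocol) (FX : Measure 𝒳) (G : Kernel 𝒳 𝒴) (z : Obs k) : ℝ :=
  ∫ x, mechX pr z.1 (x : EuclideanSpace ℝ (Fin k)) *
    (∫ y, mechY k pr z.2 (y : ℝ) ∂(G x)) ∂FX

/-- The law on `{-1, +1}^k × {0, 1}` with the point masses `obsProb`. -/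
def obsLaw (pr : Protocol) (FX : Measure 𝒳) (G : Kernel 𝒳 𝒴) : Measure (Obs k) :=
  Measure.count.withDensity fun z ↦ ENNReal.ofReal (obsProb pr FX G z)

/-- `p̂(z^(X)) = ∫ Q(z^(X) | x) dF̂X(x)`. -/
def pHat (pr : Protocol) (FXhat : Measure 𝒳) (zX : Fin k → Bool) : ℝ :=
  ∫ x, mechX pr zX (x : EuclideanSpace ℝ (Fin k)) ∂FXhat

/-- `Λ(x)`: the probability that the response bit is `1` given `X = x`, when `Y | X = x ∼ G x`. -/
def respProb (pr : Protocol) (G : Kernel 𝒳 𝒴) (x : 𝒳) : ℝ :=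
  ∫ y, mechY k pr true (y : ℝ) ∂(G x)

/-- `Φ(β, z^(X)) = F̂X(Λ(β, X) Q(z^(X) | X)) / p̂(z^(X))`. -/
def Phi (pr : Protocol) (FXhat : Measure 𝒳) (Fmod : EuclideanSpace ℝ (Fin d) → Kernel 𝒳 𝒴)
    (β : EuclideanSpace ℝ (Fin d)) (zX : Fin k → Bool) : ℝ :=
  (∫ x, respProb pr (Fmod β) x * mechX pr zX (x : EuclideanSpace ℝ (Fin k)) ∂FXhat) /
    pHat pr FXhat zX

/-- `log p_β(z^(X), z^(Y))`, where `p_β` is the joint probability under the provisional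
distribution `F̂X` and the model `F_β(· | x)`. -/
def logModel (pr : Protocol) (FXhat : Measure 𝒳)
    (Fmod : EuclideanSpace ℝ (Fin d) → Kernel 𝒳 𝒴) (β : EuclideanSpace ℝ (Fin d))
    (z : Obs k) : ℝ :=
  Real.log (obsProb pr FXhat (Fmod β) z)

/-- The log-likelihood `ℓ(β; D_n)` of the submissions `D_n`. -/
def logLik (pr : Protocol) (FXhat : Measure 𝒳)
    (Fmod : EuclideanSpace ℝ (Fin d) → Kernel 𝒳 𝒴) {n : ℕ} (D : Fin n → Obs k)
    (β : EuclideanSpace ℝ (Fin d)) : ℝ :=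
  (1 / (n : ℝ)) * ∑ i, (Real.log (pHat pr FXhat (D i).1) +
    if (D i).2 then Real.log (Phi pr FXhat Fmod β (D i).1)
    else Real.log (1 - Phi pr FXhat Fmod β (D i).1))

end Model

section Derivatives

variable {d : ℕ}

/-- The partial derivative `∂g/∂β_j`. -/
def pderiv (g : EuclideanSpace ℝ (Fin d) → ℝ) (j : Fin d) (β : EuclideanSpace ℝ (Fin d)) : ℝ :=
  fderiv ℝ g β (EuclideanSpace.single j 1)

/-- The matrix `g'(β) g'(β)ᵀ`. -/
def gradOuter (g : EuclideanSpace ℝ (Fin d) → ℝ) (β : EuclideanSpace ℝ (Fin d)) :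
    Matrix (Fin d) (Fin d) ℝ :=
  Matrix.of fun i j ↦ pderiv g i β * pderiv g j β

/-- The matrix `g''(β)` of second partial derivatives. -/
def hess (g : EuclideanSpace ℝ (Fin d) → ℝ) (β : EuclideanSpace ℝ (Fin d)) :
    Matrix (Fin d) (Fin d) ℝ :=
  Matrix.of fun i j ↦ pderiv (pderiv g j) i β

/-- The entrywise expectation of a random matrix. -/
def expMatrix {Ω : Type*} [MeasurableSpace Ω] (P : Measure Ω)
    (M : Ω → Matrix (Fin d) (Fin d) ℝ) : Matrix (Fin d) (Fin d) ℝ :=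
  Matrix.of fun i j ↦ ∫ ω, M ω i j ∂P

end Derivatives

section Information

variable {k d : ℕ} {𝒳 : Set (EuclideanSpace ℝ (Fin k))} {𝒴 : Set ℝ}

/-- `A(β) = P ∂² log p_β / ∂β²`. -/
def matA (pr : Protocol) (P : Measure (Obs k)) (FXhat : Measure 𝒳)
    (Fmod : EuclideanSpace ℝ (Fin d) → Kernel 𝒳 𝒴) (β : EuclideanSpace ℝ (Fin d)) :
    Matrix (Fin d) (Fin d) ℝ :=
  expMatrix P fun z ↦ hess (fun b ↦ logModel pr FXhat Fmod b z) β

/-- `B(β) = P (∂ log p_β / ∂β) (∂ log p_β / ∂β)ᵀ`. -/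
def matB (pr : Protocol) (P : Measure (Obs k)) (FXhat : Measure 𝒳)
    (Fmod : EuclideanSpace ℝ (Fin d) → Kernel 𝒳 𝒴) (β : EuclideanSpace ℝ (Fin d)) :
    Matrix (Fin d) (Fin d) ℝ :=
  expMatrix P fun z ↦ gradOuter (fun b ↦ logModel pr FXhat Fmod b z) β

end Information

end PrivateQMLE

end

/-! Submissions take finitely many values, so the log-likelihood is a finite sum of the fixed
functions `logModel`, and the data enter only through relative frequencies. These converge almost
surely to the probabilities under `P`; on each such sample path the analysis of the maximizer is
deterministic. Compactness makes the criterion converge uniformly on `B`, which gives consistency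
(`tendsto_maximizer`). Linearizing the score equation at `β*` shows that the estimation error is
asymptotically equivalent to minus `A⁻¹` times the average score (`isEquivalent_root_sub`). The
score has mean zero at `β*`, so the central limit theorem applies to this average and gives
covariance `A⁻¹ B A⁻¹`; `tendstoInDistribution_smul_of_isEquivalent` carries the limit over to the
estimator. It remains to see that `log p_β` is continuous on `B` and `C²` at `β*`. The bit flip
keeps every probability strictly between 0 and 1, hence also `Φ` (`Phi_mem_Ioo`), so the logarithms
are harmless. Continuity of `Φ` comes from Scheffé's lemma (`continuousOn_Phi`), and its smoothness
is assumed. -/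

/-! ### Multivariate central limit theorem -/

section CentralLimit

variable {d : ℕ} {Ω : Type*} [MeasurableSpace Ω] {Pr : Measure Ω}

/-- The quadratic form of a second moment matrix is a second moment. -/
lemma dotProduct_secondMoment_mulVec {X : Ω → EuclideanSpace ℝ (Fin d)} (hX : MemLp X 2 Pr)
    {S : Matrix (Fin d) (Fin d) ℝ} (hS : ∀ i j, S i j = ∫ ω, X ω i * X ω j ∂Pr)
    (t : Fin d → ℝ) :
    t ⬝ᵥ S.mulVec t = ∫ ω, (∑ i, X ω i * t i) ^ 2 ∂Pr := by
  have hc (i : Fin d) : MemLp (fun ω ↦ X ω i) 2 Pr :=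
    (EuclideanSpace.proj i : EuclideanSpace ℝ (Fin d) →L[ℝ] ℝ).comp_memLp' hX
  have hint (i j : Fin d) : Integrable (fun ω ↦ X ω i * X ω j) Pr := (hc i).integrable_mul (hc j)
  have hsq (ω : Ω) : (∑ i, X ω i * t i) ^ 2 = ∑ i, ∑ j, t i * t j * (X ω i * X ω j) := by
    rw [sq, Finset.sum_mul_sum]
    exact Finset.sum_congr rfl fun i _ ↦ Finset.sum_congr rfl fun j _ ↦ by ring
  simp_rw [hsq]
  rw [integral_finsetSum _ fun i _ ↦ integrable_finsetSum _ fun j _ ↦ (hint i j).const_mul _]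
  simp_rw [integral_finsetSum _ fun j _ ↦ (hint _ j).const_mul _, integral_const_mul, ← hS,
    dotProduct, Matrix.mulVec, dotProduct, Finset.mul_sum]
  exact Finset.sum_congr rfl fun i _ ↦ Finset.sum_congr rfl fun j _ ↦ by ring

/-- A second moment matrix is positive semidefinite. -/
lemma posSemidef_secondMoment {X : Ω → EuclideanSpace ℝ (Fin d)} (hX : MemLp X 2 Pr)
    {S : Matrix (Fin d) (Fin d) ℝ} (hS : ∀ i j, S i j = ∫ ω, X ω i * X ω j ∂Pr) :
    S.PosSemidef := by
  refine Matrix.PosSemidef.of_dotProduct_mulVec_nonneg ?_ fun t ↦ ?_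
  · ext i j
    simp [hS, mul_comm]
  · rw [star_trivial, dotProduct_secondMoment_mulVec hX hS]
    exact integral_nonneg fun ω ↦ sq_nonneg _

/-- **Multivariate central limit theorem** for centred, independent and identically distributed
random vectors. -/
theorem tendstoInDistribution_inv_sqrt_smul_sum [IsProbabilityMeasure Pr]
    {X : ℕ → Ω → EuclideanSpace ℝ (Fin d)} (hX : MemLp (X 0) 2 Pr)
    (hmean : ∫ ω, X 0 ω ∂Pr = 0) (hindep : iIndepFun X Pr)
    (hident : ∀ i, IdentDistrib (X i) (X 0) Pr Pr)
    {S : Matrix (Fin d) (Fin d) ℝ} (hS : ∀ i j, S i j = ∫ ω, X 0 ω i * X 0 ω j ∂Pr) :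
    TendstoInDistribution (fun (n : ℕ) ω ↦ (√(n : ℝ))⁻¹ • ∑ i ∈ Finset.range n, X i ω) atTop
      (id : EuclideanSpace ℝ (Fin d) → EuclideanSpace ℝ (Fin d)) (fun _ ↦ Pr)
      (multivariateGaussian 0 S) := by
  have mX (i : ℕ) : AEMeasurable (X i) Pr := (hident i).aemeasurable_fst
  have hmeas (n : ℕ) : AEMeasurable (fun ω ↦ (√(n : ℝ))⁻¹ • ∑ i ∈ Finset.range n, X i ω) Pr :=
    AEMeasurable.const_smul (Finset.aemeasurable_fun_sum (Finset.range n) fun i _ ↦ mX i)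
      ((√(n : ℝ))⁻¹)
  refine ⟨hmeas, aemeasurable_id, ?_⟩
  refine ProbabilityMeasure.tendsto_iff_tendsto_charFun.2 fun t ↦ ?_
  have hin : ∀ x : EuclideanSpace ℝ (Fin d), inner ℝ x t = ∑ i, x i * t i := fun x ↦ by
    simp [PiLp.inner_apply, mul_comm]
  have hcont : Measurable fun x : EuclideanSpace ℝ (Fin d) ↦ inner ℝ x t := by fun_prop
  have hY : MemLp (fun ω ↦ inner ℝ (X 0 ω) t) 2 Pr := by
    simpa [real_inner_comm, Function.comp_def] using (innerSL ℝ t).comp_memLp' hX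
  have hm0 : ∫ ω, inner ℝ (X 0 ω) t ∂Pr = 0 := by
    have := integral_inner (𝕜 := ℝ) (hX.integrable (by norm_num)) t
    simpa [hmean, real_inner_comm] using this
  have hvar : Var[fun ω ↦ inner ℝ (X 0 ω) t; Pr] = (t : Fin d → ℝ) ⬝ᵥ S.mulVec t := by
    rw [variance_of_integral_eq_zero hY.1.aemeasurable hm0, dotProduct_secondMoment_mulVec hX hS]
    simp_rw [hin]
  have hlim := tendstoInDistribution_inv_sqrt_mul_sum_sub (P := Pr)
    (X := fun i ω ↦ inner ℝ (X i ω) t) (Y := id) ⟨aemeasurable_id, Measure.map_id⟩ hY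
    (hindep.comp (fun _ x ↦ inner ℝ x t) fun _ ↦ hcont) fun i ↦ (hident i).comp hcont
  have hlim1 := ProbabilityMeasure.tendsto_iff_tendsto_charFun.1 hlim.tendsto 1
  -- Cramér–Wold: the characteristic function at `t` is that of the projection `⟨x, t⟩` at 1, which
  -- reduces the claim to the one-dimensional limit theorem.
  have hone {μ : Measure (EuclideanSpace ℝ (Fin d))} :
      charFun μ t = charFun (μ.map fun x ↦ inner ℝ x t) 1 := by
    rw [charFun_apply, charFun_apply, integral_map hcont.aemeasurable (by fun_prop)]
    simp
  convert hlim1 using 2 with n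
  · simp only [ProbabilityMeasure.coe_mk]
    rw [hone, AEMeasurable.map_map_of_aemeasurable hcont.aemeasurable (hmeas n)]
    congr 2
    funext ω
    simp [inner_smul_left, sum_inner, hm0]
  · simp only [ProbabilityMeasure.coe_mk, Measure.map_id]
    rw [charFun_multivariateGaussian (posSemidef_secondMoment hX hS), charFun_gaussianReal, hvar,
      Real.coe_toNNReal]
    · simp
    · rw [dotProduct_secondMoment_mulVec hX hS]
      exact integral_nonneg fun ω ↦ sq_nonneg _

end CentralLimit

/-! ### Relative frequencies and the strong law -/

section EmpiricalFrequencies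

variable {Ω 𝒵 : Type*} [Fintype 𝒵] [DecidableEq 𝒵]

/-- The relative frequency of `z` among the first `n` observations. -/
noncomputable def empFreq (Z : ℕ → Ω → 𝒵) (n : ℕ) (ω : Ω) (z : 𝒵) : ℝ :=
  (n : ℝ)⁻¹ * ∑ i ∈ Finset.range n, if Z i ω = z then 1 else 0

/-- Grouping the observations by value turns a sample average into a sum over the finite space. At
`n = 0` both sides vanish because `0⁻¹ = 0`. -/
lemma sum_empFreq_smul {E : Type*} [AddCommGroup E] [Module ℝ E] (Z : ℕ → Ω → 𝒵) (n : ℕ) (ω : Ω)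
    (φ : 𝒵 → E) :
    ∑ z, empFreq Z n ω z • φ z = (n : ℝ)⁻¹ • ∑ i ∈ Finset.range n, φ (Z i ω) := by
  simp_rw [empFreq, mul_smul, ← Finset.smul_sum, Finset.sum_smul]
  rw [Finset.sum_comm]
  simp [ite_smul]

variable [MeasurableSpace Ω] [MeasurableSpace 𝒵] [MeasurableSingletonClass 𝒵] {Pr : Measure Ω}
  [IsProbabilityMeasure Pr] {P : Measure 𝒵}

/-- The relative frequencies of independent observations converge almost surely. -/
lemma ae_tendsto_empFreq {Z : ℕ → Ω → 𝒵} (hindep : iIndepFun Z Pr)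
    (hlaw : ∀ i, HasLaw (Z i) P Pr) :
    ∀ᵐ ω ∂Pr, ∀ z, Tendsto (fun n ↦ empFreq Z n ω z) atTop (𝓝 (P.real {z})) := by
  rw [ae_all_iff]
  intro z
  have hP : IsProbabilityMeasure P := by
    rw [← (hlaw 0).map_eq]
    exact Measure.isProbabilityMeasure_map (hlaw 0).aemeasurable
  have hφ : Measurable fun y : 𝒵 ↦ if y = z then (1 : ℝ) else 0 := measurable_of_finite _
  have hident (i : ℕ) : IdentDistrib (Z i) (Z 0) Pr Pr :=
    ⟨(hlaw i).aemeasurable, (hlaw 0).aemeasurable, (hlaw i).map_eq.trans (hlaw 0).map_eq.symm⟩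
  have hmean : ∫ ω, (if Z 0 ω = z then (1 : ℝ) else 0) ∂Pr = P.real {z} := by
    have := (hlaw 0).integral_comp (f := fun y : 𝒵 ↦ if y = z then (1 : ℝ) else 0)
      hφ.aestronglyMeasurable
    simp only [Function.comp_def] at this
    rw [this, integral_fintype Integrable.of_finite]
    simp
  have hint : Integrable (fun ω ↦ if Z 0 ω = z then (1 : ℝ) else 0) Pr :=
    Integrable.of_bound (hφ.comp_aemeasurable (hlaw 0).aemeasurable).aestronglyMeasurable 1
      (ae_of_all _ fun ω ↦ by split_ifs <;> simp)
  have := strong_law_ae (fun i ω ↦ if Z i ω = z then (1 : ℝ) else 0) hint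
    (fun i j hij ↦ (hindep.indepFun hij).comp hφ hφ) fun i ↦ (hident i).comp hφ
  rw [hmean] at this
  exact this

end EmpiricalFrequencies

/-! ### Consistency and linearization along a fixed sample path -/

section Deterministic

variable {𝒵 : Type*} [Fintype 𝒵]

/-- Maximizers of weighted criteria converge when the weights converge and the limit criterion has
a unique maximizer on a compact set. -/
lemma tendsto_maximizer {E : Type*} [TopologicalSpace E] {B : Set E} (hB : IsCompact B)
    {m : E → 𝒵 → ℝ} (hm : ∀ z, ContinuousOn (fun β ↦ m β z) B) {q : 𝒵 → ℝ} {βs : E}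
    (hβs : βs ∈ B) (hmax : ∀ β ∈ B, β ≠ βs → ∑ z, q z * m β z < ∑ z, q z * m βs z)
    {p : ℕ → 𝒵 → ℝ} (hp : ∀ z, Tendsto (fun n ↦ p n z) atTop (𝓝 (q z))) {b : ℕ → E}
    (hb : ∀ n, b n ∈ B) (hbmax : ∀ n, IsMaxOn (fun β ↦ ∑ z, p n z * m β z) B (b n)) :
    Tendsto b atTop (𝓝 βs) := by
  have hbound (z : 𝒵) : ∃ C, ∀ β ∈ B, ‖m β z‖ ≤ C := hB.exists_bound_of_continuousOn (hm z)
  choose C hC using hbound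
  have hdiff : Tendsto (fun n ↦ ∑ z, |p n z - q z| * C z) atTop (𝓝 0) := by
    have : Tendsto (fun n ↦ ∑ z, |p n z - q z| * C z) atTop (𝓝 (∑ z, |q z - q z| * C z)) :=
      tendsto_finsetSum _ fun z _ ↦ (((hp z).sub_const _).abs).mul_const _
    simpa using this
  -- The deviation from the limit criterion is bounded uniformly over `B`.
  have hclose (n : ℕ) {β : E} (hβ : β ∈ B) :
      |∑ z, p n z * m β z - ∑ z, q z * m β z| ≤ ∑ z, |p n z - q z| * C z := by
    rw [← Finset.sum_sub_distrib]
    refine (Finset.abs_sum_le_sum_abs _ _).trans (Finset.sum_le_sum fun z _ ↦ ?_)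
    rw [← sub_mul, abs_mul]
    exact mul_le_mul_of_nonneg_left (hC z β hβ) (abs_nonneg _)
  rw [tendsto_nhds]
  intro U hU hβU
  have hcont : ContinuousOn (fun β ↦ ∑ z, q z * m β z) (B \ U) :=
    continuousOn_finsetSum _ fun z _ ↦ continuousOn_const.mul ((hm z).mono Set.sdiff_subset)
  rcases (B \ U).eq_empty_or_nonempty with hempty | hne
  · exact Eventually.of_forall fun n ↦ Set.sdiff_eq_empty.1 hempty (hb n)
  obtain ⟨β', hβ', hβ'max⟩ := (hB.diff hU).exists_isMaxOn hne hcont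
  have hlt := hmax β' hβ'.1 (fun h ↦ hβ'.2 (h ▸ hβU))
  -- Half the gap between the maximum and the best value outside `U`: the uniform error is incurred
  -- twice, at `βs` and at `b n`.
  have hgap : 0 < (∑ z, q z * m βs z - ∑ z, q z * m β' z) / 2 := by linarith
  filter_upwards [hdiff.eventually (gt_mem_nhds hgap)] with n hn
  by_contra hnU
  have h1 : ∑ z, q z * m (b n) z ≤ ∑ z, q z * m β' z := hβ'max ⟨hb n, hnU⟩
  have h2 : ∑ z, p n z * m βs z ≤ ∑ z, p n z * m (b n) z := hbmax n hβs
  have h3 := abs_le.1 (hclose n hβs)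
  have h4 := abs_le.1 (hclose n (hb n))
  linarith [h3.1, h4.2]

/-- Linearization of the roots of weighted estimating equations. -/
lemma isEquivalent_root_sub {E : Type*} [NormedAddCommGroup E] [NormedSpace ℝ E]
    {G : 𝒵 → E → E} {L : 𝒵 → E →L[ℝ] E} {βs : E} (hG : ∀ z, HasFDerivAt (G z) (L z) βs)
    {q : 𝒵 → ℝ} {K : E →L[ℝ] E} (hK : ∀ x, K (∑ z, q z • L z x) = x)
    {p : ℕ → 𝒵 → ℝ} (hp : ∀ z, Tendsto (fun n ↦ p n z) atTop (𝓝 (q z)))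
    {b : ℕ → E} (hb : Tendsto b atTop (𝓝 βs)) (hroot : ∀ᶠ n in atTop, ∑ z, p n z • G z (b n) = 0) :
    Asymptotics.IsEquivalent atTop (fun n ↦ b n - βs) fun n ↦ -K (∑ z, p n z • G z βs) := by
  -- All remainders are naturally small relative to `b n - βs`, so the equivalence is proved in that
  -- direction; no rate of convergence is needed.
  refine Asymptotics.IsEquivalent.symm ?_
  -- Two sources of error: the Taylor remainder of `G z`, with bounded weight, and (`h2`) the
  -- replacement of `p n z` by `q z` in the linear term.
  have h1 (z : 𝒵) : (fun n ↦ p n z • (G z (b n) - G z βs - L z (b n - βs)))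
      =o[atTop] fun n ↦ b n - βs := by
    have hlo := (hG z).isLittleO.comp_tendsto hb
    simpa using ((hp z).isBigO_one ℝ).smul_isLittleO hlo
  have h2 (z : 𝒵) : (fun n ↦ (p n z - q z) • L z (b n - βs)) =o[atTop] fun n ↦ b n - βs := by
    have hp0 : (fun n ↦ p n z - q z) =o[atTop] fun _ ↦ (1 : ℝ) := by
      rw [Asymptotics.isLittleO_one_iff]
      simpa using (hp z).sub_const (q z)
    simpa using hp0.smul_isBigO ((L z).isBigO_comp (fun n ↦ b n - βs) atTop)
  have h3 := Asymptotics.IsLittleO.sum (s := Finset.univ) fun z _ ↦ (h1 z).add (h2 z)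
  have h4 := (K.isBigO_comp _ atTop).trans_isLittleO h3
  refine h4.congr' ?_ EventuallyEq.rfl
  filter_upwards [hroot] with n hn
  have hsum : ∑ z, (p n z • (G z (b n) - G z βs - L z (b n - βs)) +
      (p n z - q z) • L z (b n - βs)) =
      ∑ z, p n z • G z (b n) - ∑ z, p n z • G z βs - ∑ z, q z • L z (b n - βs) := by
    simp_rw [← Finset.sum_sub_distrib]
    exact Finset.sum_congr rfl fun z _ ↦ by module
  rw [Finset.sum_apply, hsum, hn, map_sub, map_sub, hK]
  simp

end Deterministic

/-! ### Gradients and Hessian matrices -/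

section SecondOrder

variable {d : ℕ}

open PrivateQMLE

lemma gradient_apply_eq_pderiv (g : EuclideanSpace ℝ (Fin d) → ℝ) (β : EuclideanSpace ℝ (Fin d))
    (j : Fin d) : gradient g β j = pderiv g j β := by
  rw [pderiv, ← toDual_gradient, InnerProductSpace.toDual_apply_apply, EuclideanSpace.inner_single_right]
  simp

lemma hess_apply_eq {g : EuclideanSpace ℝ (Fin d) → ℝ} {β : EuclideanSpace ℝ (Fin d)}
    (hg : ContDiffAt ℝ 2 g β) (i j : Fin d) :
    hess g β i j = fderiv ℝ (fderiv ℝ g) β (EuclideanSpace.single i 1)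
      (EuclideanSpace.single j 1) := by
  have hd : DifferentiableAt ℝ (fderiv ℝ g) β :=
    (hg.fderiv_right (m := 1) (by norm_num)).differentiableAt (by norm_num)
  simp only [hess, Matrix.of_apply]
  unfold pderiv
  rw [fderiv_clm_apply hd (by fun_prop)]
  simp

/-- Schwarz's theorem. It is the reason why the sandwich covariance carries no transpose. -/
lemma hess_transpose {g : EuclideanSpace ℝ (Fin d) → ℝ} {β : EuclideanSpace ℝ (Fin d)}
    (hg : ContDiffAt ℝ 2 g β) : (hess g β).transpose = hess g β := by
  ext i j
  rw [Matrix.transpose_apply, hess_apply_eq hg, hess_apply_eq hg]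
  exact hg.isSymmSndFDerivAt (by simp) _ _

/-- The Hessian matrix is the derivative of the gradient. -/
lemma hasFDerivAt_gradient {g : EuclideanSpace ℝ (Fin d) → ℝ} {β : EuclideanSpace ℝ (Fin d)}
    (hg : ContDiffAt ℝ 2 g β) :
    HasFDerivAt (gradient g) (Matrix.toEuclideanCLM (𝕜 := ℝ) (hess g β)) β := by
  have hd : DifferentiableAt ℝ (fderiv ℝ g) β :=
    (hg.fderiv_right (m := 1) (by norm_num)).differentiableAt (by norm_num)
  -- The gradient is `fderiv` followed by the inverse Riesz isomorphism, which is linear.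
  have h := (InnerProductSpace.toDual ℝ (EuclideanSpace ℝ (Fin d))).symm.toContinuousLinearEquiv
    |>.hasFDerivAt.comp β hd.hasFDerivAt
  refine h.congr_fderiv ?_
  refine ContinuousLinearMap.coe_injective
    ((EuclideanSpace.basisFun (Fin d) ℝ).toBasis.ext fun i ↦ ?_)
  ext j
  have hj (y : StrongDual ℝ (EuclideanSpace ℝ (Fin d))) :
      (InnerProductSpace.toDual ℝ (EuclideanSpace ℝ (Fin d))).symm y j
        = y (EuclideanSpace.single j 1) := by
    rw [← InnerProductSpace.toDual_symm_apply, EuclideanSpace.inner_single_right]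
    simp
  have h1 := hess_apply_eq hg i j
  -- The row index of `hess` is the direction of the outer derivative, so the Jacobian of the
  -- gradient is a priori its transpose.
  rw [← hess_transpose hg, Matrix.transpose_apply] at h1
  simp [hj, Matrix.ofLp_toEuclideanCLM, h1]

end SecondOrder

/-! ### Asymptotic normality of M-estimators on a finite sample space -/

section MEstimation

open PrivateQMLE

variable {d : ℕ} {𝒵 : Type*} [Fintype 𝒵]

/-- The first order condition for a local maximizer of a weighted criterion. -/
lemma sum_smul_gradient_eq_zero {m : EuclideanSpace ℝ (Fin d) → 𝒵 → ℝ} {p : 𝒵 → ℝ}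
    {β : EuclideanSpace ℝ (Fin d)} (hm : ∀ z, DifferentiableAt ℝ (fun b ↦ m b z) β)
    (hmax : IsLocalMax (fun b ↦ ∑ z, p z * m b z) β) :
    ∑ z, p z • gradient (fun b ↦ m b z) β = 0 := by
  have h := hmax.hasFDerivAt_eq_zero
    (HasFDerivAt.fun_sum fun z _ ↦ (hm z).hasFDerivAt.const_mul (p z))
  have h' := congrArg (InnerProductSpace.toDual ℝ (EuclideanSpace ℝ (Fin d))).symm h
  simpa [gradient] using h'

/-- Two sequences of random vectors that are almost surely equivalent have the same limit in
distribution after rescaling. -/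
lemma tendstoInDistribution_smul_of_isEquivalent {E Ω Ω' : Type*} [NormedAddCommGroup E]
    [NormedSpace ℝ E] [MeasurableSpace E] [BorelSpace E] [SecondCountableTopology E]
    [MeasurableSpace Ω] {Pr : Measure Ω} [IsProbabilityMeasure Pr] [MeasurableSpace Ω']
    {Q : Measure Ω'} [IsProbabilityMeasure Q] {a : ℕ → ℝ} (ha : ∀ n, 0 ≤ a n)
    {δ T : ℕ → Ω → E} (hδ : ∀ n, AEMeasurable (δ n) Pr) (hTm : ∀ n, AEMeasurable (T n) Pr)
    {Y : Ω' → E}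
    (hlim : TendstoInDistribution (fun n ω ↦ a n • T n ω) atTop Y (fun _ ↦ Pr) Q)
    (hequiv : ∀ᵐ ω ∂Pr, Asymptotics.IsEquivalent atTop (fun n ↦ δ n ω) fun n ↦ T n ω) :
    TendstoInDistribution (fun n ω ↦ a n • δ n ω) atTop Y (fun _ ↦ Pr) Q := by
  -- Relative error, chosen so that `a δ = a T + ‖a T‖ u` whenever `T ≠ 0`; Slutsky's theorem then
  -- applies to the pair `(a T, u)`.
  set u : ℕ → Ω → E := fun n ω ↦ ‖T n ω‖⁻¹ • (δ n ω - T n ω) with hu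
  have hum (n : ℕ) : AEMeasurable (u n) Pr := (hTm n).norm.inv.smul ((hδ n).sub (hTm n))
  have hu0 : ∀ᵐ ω ∂Pr, Tendsto (fun n ↦ u n ω) atTop (𝓝 0) := by
    filter_upwards [hequiv] with ω hω
    rw [tendsto_zero_iff_norm_tendsto_zero]
    refine hω.isLittleO.norm_norm.tendsto_div_nhds_zero.congr fun n ↦ ?_
    simp [hu, norm_smul, div_eq_inv_mul]
  have hslut := hlim.continuous_comp_prodMk_of_tendstoInMeasure_const
    (g := fun x : E × E ↦ x.1 + ‖x.1‖ • x.2)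
    (by fun_prop) (tendstoInMeasure_of_tendsto_ae (fun n ↦ (hum n).aestronglyMeasurable) hu0) hum
  simp only [smul_zero, add_zero] at hslut
  have haδ (n : ℕ) : AEMeasurable (fun ω ↦ a n • δ n ω) Pr := AEMeasurable.const_smul (hδ n) (a n)
  refine tendstoInDistribution_of_tendstoInMeasure_sub _ _ hslut ?_ haδ
  refine tendstoInMeasure_of_tendsto_ae
    (fun n ↦ ((haδ n).sub (hslut.forall_aemeasurable n)).aestronglyMeasurable) ?_
  filter_upwards [hequiv] with ω hω
  refine tendsto_const_nhds.congr' ?_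
  -- Where `T = 0`, the convention `0⁻¹ = 0` loses `δ`, but equivalence forces `δ = 0` there for all
  -- large `n`.
  filter_upwards [hω.isLittleO.isBigO.eq_zero_imp] with n hn
  simp only [Pi.sub_apply, Pi.zero_apply, hu] at hn ⊢
  rcases eq_or_ne (T n ω) 0 with h0 | h0
  · have hδ0 : δ n ω = 0 := by simpa [h0] using hn h0
    simp [h0, hδ0]
  · rw [norm_smul, Real.norm_of_nonneg (ha n), smul_smul,
      mul_assoc, mul_inv_cancel₀ (norm_ne_zero_iff.2 h0), mul_one, smul_sub]
    abel

/-- **Asymptotic normality of M-estimators** based on independent observations in a finite space: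
if the criterion is continuous on a compact parameter set and twice continuously differentiable at
the unique, interior maximizer of its expectation, with nonsingular expected Hessian there, then the
estimation error is asymptotically normal with the sandwich covariance. -/
theorem tendstoInDistribution_mEstimator [MeasurableSpace 𝒵] [MeasurableSingletonClass 𝒵]
    {P : Measure 𝒵} {B : Set (EuclideanSpace ℝ (Fin d))} (hB : IsCompact B)
    {m : EuclideanSpace ℝ (Fin d) → 𝒵 → ℝ} (hcont : ∀ z, ContinuousOn (fun β ↦ m β z) B)
    {βs : EuclideanSpace ℝ (Fin d)} (hβs : βs ∈ interior B)
    (hmax : ∀ β ∈ B, β ≠ βs → ∫ z, m β z ∂P < ∫ z, m βs z ∂P)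
    (hsmooth : ∀ z, ContDiffAt ℝ 2 (fun β ↦ m β z) βs)
    (hA : IsUnit (expMatrix P fun z ↦ hess (fun β ↦ m β z) βs).det)
    {Ω : Type*} [MeasurableSpace Ω] {Pr : Measure Ω} [IsProbabilityMeasure Pr]
    {Z : ℕ → Ω → 𝒵} (hindep : iIndepFun Z Pr) (hlaw : ∀ i, HasLaw (Z i) P Pr)
    {βhat : ℕ → Ω → EuclideanSpace ℝ (Fin d)} (hmeas : ∀ n, AEMeasurable (βhat n) Pr)
    (hβhat : ∀ n ω, βhat n ω ∈ B ∧
      IsMaxOn (fun β ↦ (n : ℝ)⁻¹ * ∑ i ∈ Finset.range n, m β (Z i ω)) B (βhat n ω)) :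
    TendstoInDistribution
      (fun (n : ℕ) (ω : Ω) ↦ √(n : ℝ) • (βhat n ω - βs)) atTop
      (id : EuclideanSpace ℝ (Fin d) → EuclideanSpace ℝ (Fin d)) (fun _ ↦ Pr)
      (multivariateGaussian 0
        ((expMatrix P fun z ↦ hess (fun β ↦ m β z) βs)⁻¹ *
          (expMatrix P fun z ↦ gradOuter (fun β ↦ m β z) βs) *
          (expMatrix P fun z ↦ hess (fun β ↦ m β z) βs)⁻¹)) := by
  classical
  have hP : IsProbabilityMeasure P := by
    rw [← (hlaw 0).map_eq]
    exact Measure.isProbabilityMeasure_map (hlaw 0).aemeasurable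
  set A := expMatrix P fun z ↦ hess (fun β ↦ m β z) βs with hAdef
  have hAsum : A = ∑ z, P.real {z} • hess (fun β ↦ m β z) βs := by
    ext i j
    simp [hAdef, expMatrix, integral_fintype Integrable.of_finite, Matrix.sum_apply]
  have hAT : A.transpose = A := by
    rw [hAsum, Matrix.transpose_sum]
    exact Finset.sum_congr rfl fun z _ ↦ by rw [Matrix.transpose_smul, hess_transpose (hsmooth z)]
  simp_rw [integral_fintype (Integrable.of_finite (μ := P)), smul_eq_mul] at hmax
  set G : 𝒵 → EuclideanSpace ℝ (Fin d) → EuclideanSpace ℝ (Fin d) :=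
    fun z ↦ gradient fun β ↦ m β z with hG
  have hBsum : (expMatrix P fun z ↦ gradOuter (fun β ↦ m β z) βs) =
      ∑ z, P.real {z} • Matrix.vecMulVec (G z βs) (G z βs) := by
    ext i j
    simp [expMatrix, integral_fintype Integrable.of_finite, Matrix.sum_apply, gradOuter, hG,
      Matrix.vecMulVec_apply, gradient_apply_eq_pderiv]
  set K : EuclideanSpace ℝ (Fin d) →L[ℝ] EuclideanSpace ℝ (Fin d) :=
    Matrix.toEuclideanCLM (𝕜 := ℝ) A⁻¹ with hKdef
  have hK (x : EuclideanSpace ℝ (Fin d)) :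
      K (∑ z, P.real {z} • Matrix.toEuclideanCLM (𝕜 := ℝ) (hess (fun β ↦ m β z) βs) x) = x := by
    have : ∑ z, P.real {z} • Matrix.toEuclideanCLM (𝕜 := ℝ) (hess (fun β ↦ m β z) βs) x =
        Matrix.toEuclideanCLM (𝕜 := ℝ) A x := by
      simp [hAsum, map_sum, map_smul]
    rw [this, hKdef, ← mul_apply_eq_comp, ← map_mul, Matrix.nonsing_inv_mul _ hA,
      map_one, one_apply_eq_self]
  have hdiff (z : 𝒵) : ∀ᶠ β in 𝓝 βs, DifferentiableAt ℝ (fun b ↦ m b z) β := by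
    filter_upwards [(hsmooth z).eventually (by simp)] with β hβ
    exact hβ.differentiableAt (by norm_num)
  -- First-order condition for the expected criterion at its interior maximizer: the score is
  -- centred.
  have hscore : ∑ z, P.real {z} • G z βs = 0 := by
    refine sum_smul_gradient_eq_zero (fun z ↦ (hdiff z).self_of_nhds) ?_
    filter_upwards [mem_interior_iff_mem_nhds.1 hβs] with β hβ
    rcases eq_or_ne β βs with rfl | hne
    · exact le_rfl
    · exact (hmax β hβ hne).le
  -- the influence function
  set w : 𝒵 → EuclideanSpace ℝ (Fin d) := fun z ↦ -K (G z βs) with hw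
  have hwm : Measurable w := measurable_of_finite _
  set X : ℕ → Ω → EuclideanSpace ℝ (Fin d) := fun i ω ↦ w (Z i ω) with hX
  set T : ℕ → Ω → EuclideanSpace ℝ (Fin d) :=
    fun n ω ↦ (n : ℝ)⁻¹ • ∑ i ∈ Finset.range n, X i ω with hT
  have hXm (i : ℕ) : AEMeasurable (X i) Pr := hwm.comp_aemeasurable (hlaw i).aemeasurable
  have hTm (n : ℕ) : AEMeasurable (T n) Pr :=
    AEMeasurable.const_smul (Finset.aemeasurable_fun_sum (Finset.range n) fun i _ ↦ hXm i)
      ((n : ℝ)⁻¹)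
  have hroot : ∀ᵐ ω ∂Pr, Asymptotics.IsEquivalent atTop (fun n ↦ βhat n ω - βs)
      fun n ↦ T n ω := by
    filter_upwards [ae_tendsto_empFreq hindep hlaw] with ω hω
    have hobj (n : ℕ) (β : EuclideanSpace ℝ (Fin d)) :
        (n : ℝ)⁻¹ * ∑ i ∈ Finset.range n, m β (Z i ω) = ∑ z, empFreq Z n ω z * m β z := by
      simpa using (sum_empFreq_smul Z n ω fun z ↦ m β z).symm
    have hbmax (n : ℕ) :
        IsMaxOn (fun β ↦ ∑ z, empFreq Z n ω z * m β z) B (βhat n ω) := by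
      simpa only [hobj] using (hβhat n ω).2
    have hcons : Tendsto (fun n ↦ βhat n ω) atTop (𝓝 βs) :=
      tendsto_maximizer hB hcont (interior_subset hβs) hmax hω (fun n ↦ (hβhat n ω).1) hbmax
    have hstat : ∀ᶠ n in atTop, ∑ z, empFreq Z n ω z • G z (βhat n ω) = 0 := by
      filter_upwards [hcons.eventually (eventually_all.2 hdiff),
        hcons.eventually (isOpen_interior.mem_nhds hβs)] with n hn hn'
      exact sum_smul_gradient_eq_zero hn
        ((hbmax n).isLocalMax (mem_interior_iff_mem_nhds.1 hn'))
    have := isEquivalent_root_sub (fun z ↦ hasFDerivAt_gradient (hsmooth z)) hK hω hcons hstat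
    refine this.congr_right (Eventually.of_forall fun n ↦ ?_)
    simp only [hT, hX]
    rw [← sum_empFreq_smul]
    simp [hw, hG]
  -- the central limit theorem for the linear part
  have hident (i : ℕ) : IdentDistrib (X i) (X 0) Pr Pr :=
    (⟨(hlaw i).aemeasurable, (hlaw 0).aemeasurable,
      (hlaw i).map_eq.trans (hlaw 0).map_eq.symm⟩ : IdentDistrib (Z i) (Z 0) Pr Pr).comp hwm
  have hlp : MemLp (X 0) 2 Pr :=
    by
    have h : MemLp w 2 (Pr.map (Z 0)) := by
      rw [(hlaw 0).map_eq]
      exact MemLp.of_discrete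
    exact h.comp_of_map (hlaw 0).aemeasurable
  have hexp {F : Type} [NormedAddCommGroup F] [NormedSpace ℝ F] [CompleteSpace F] (f : 𝒵 → F) :
      ∫ ω, f (Z 0 ω) ∂Pr = ∑ z, P.real {z} • f z := by
    rw [← integral_fintype Integrable.of_finite]
    exact (hlaw 0).integral_comp AEStronglyMeasurable.of_discrete
  have hclt := tendstoInDistribution_inv_sqrt_smul_sum (X := X)
    (S := A⁻¹ * (expMatrix P fun z ↦ gradOuter (fun β ↦ m β z) βs) * A⁻¹) hlp
    (by
      change ∫ ω, w (Z 0 ω) ∂Pr = 0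
      rw [hexp w]
      simp only [hw, smul_neg, Finset.sum_neg_distrib]
      simp_rw [← map_smul, ← map_sum, hscore, map_zero, neg_zero])
    (hindep.comp (fun _ ↦ w) fun _ ↦ hwm) hident
    (fun i j ↦ by
      change _ = ∫ ω, w (Z 0 ω) i * w (Z 0 ω) j ∂Pr
      rw [hexp fun z ↦ w z i * w z j, hBsum, Matrix.mul_sum, Matrix.sum_mul, Matrix.sum_apply]
      refine Finset.sum_congr rfl fun z _ ↦ ?_
      -- Symmetry of `A` puts the same `A⁻¹` on both sides of `B`.
      have hvec : Matrix.vecMul (G z βs) A⁻¹ = A⁻¹.mulVec (G z βs) := by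
        rw [← Matrix.mulVec_transpose, Matrix.transpose_nonsing_inv, hAT]
      rw [Matrix.mul_smul, Matrix.smul_mul, Matrix.mul_vecMulVec, Matrix.vecMulVec_mul, hvec]
      simp [hw, hKdef, Matrix.vecMulVec_apply])
  have hscale (n : ℕ) (ω : Ω) :
      (√(n : ℝ))⁻¹ • ∑ i ∈ Finset.range n, X i ω = √(n : ℝ) • T n ω := by
    simp only [hT, smul_smul]
    rw [← div_eq_mul_inv, Real.sqrt_div_self]
  simp_rw [hscale] at hclt
  exact tendstoInDistribution_smul_of_isEquivalent (fun n ↦ Real.sqrt_nonneg _)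
    (fun n ↦ (hmeas n).sub_const _) hTm hclt hroot

end MEstimation

/-! ### Integrals against converging densities -/

section DensityLimits

/-- **Scheffé's lemma**: if probability densities converge pointwise to a probability density, then
the integrals of a bounded function converge. -/
lemma tendsto_integral_withDensity {ι α : Type*} [MeasurableSpace α] {l : Filter ι}
    [l.IsCountablyGenerated] {ν : Measure α} {f : ι → α → ℝ≥0} {f₀ : α → ℝ≥0}
    (hf : ∀ᶠ i in l, Measurable (f i) ∧
      IsProbabilityMeasure (ν.withDensity fun y ↦ (f i y : ℝ≥0∞)))
    (hf₀ : Measurable f₀) [IsProbabilityMeasure (ν.withDensity fun y ↦ (f₀ y : ℝ≥0∞))]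
    (hlim : ∀ y, Tendsto (fun i ↦ f i y) l (𝓝 (f₀ y))) {g : α → ℝ} (hg : Measurable g)
    (hg1 : ∀ y, |g y| ≤ 1) :
    Tendsto (fun i ↦ ∫ y, g y ∂(ν.withDensity fun y ↦ (f i y : ℝ≥0∞))) l
      (𝓝 (∫ y, g y ∂(ν.withDensity fun y ↦ (f₀ y : ℝ≥0∞)))) := by
  have hint {h : α → ℝ≥0} (hm : Measurable h)
      (hp : IsProbabilityMeasure (ν.withDensity fun y ↦ (h y : ℝ≥0∞))) :
      Integrable (fun y ↦ (h y : ℝ)) ν ∧ ∫ y, (h y : ℝ) ∂ν = 1 := by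
    have h1 := (integrable_withDensity_iff_integrable_smul (μ := ν) hm).1
      (integrable_const (1 : ℝ))
    have h2 := integral_withDensity_eq_integral_smul (μ := ν) hm fun _ ↦ (1 : ℝ)
    simp only [NNReal.smul_def, smul_eq_mul, mul_one] at h1 h2
    exact ⟨h1, by simpa using h2.symm⟩
  have hg' {h : α → ℝ≥0} (hm : Measurable h) :
      ∫ y, g y ∂(ν.withDensity fun y ↦ (h y : ℝ≥0∞)) = ∫ y, (h y : ℝ) * g y ∂ν := by
    rw [integral_withDensity_eq_integral_smul hm]
    simp [NNReal.smul_def]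
  have hgint {h : α → ℝ} (hi : Integrable h ν) : Integrable (fun y ↦ h y * g y) ν :=
    hi.mul_bdd hg.aestronglyMeasurable (ae_of_all _ hg1)
  obtain ⟨hi₀, h1₀⟩ := hint hf₀ inferInstance
  -- The densities need have no common integrable bound, but their minima with `f₀` are dominated by
  -- `f₀`. The `L¹` distance is then controlled by `|a - b| = a + b - 2 min a b`, as both densities
  -- have integral 1.
  have hmin : Tendsto (fun i ↦ ∫ y, min (f i y : ℝ) (f₀ y) ∂ν) l (𝓝 1) := by
    rw [← h1₀]
    refine tendsto_integral_filter_of_dominated_convergence (fun y ↦ (f₀ y : ℝ)) ?_ ?_ hi₀ ?_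
    · filter_upwards [hf] with i hi
      have := hi.1
      exact Measurable.aestronglyMeasurable (by fun_prop)
    · refine Eventually.of_forall fun i ↦ ae_of_all _ fun y ↦ ?_
      rw [Real.norm_of_nonneg (le_min (NNReal.coe_nonneg _) (NNReal.coe_nonneg _))]
      exact min_le_right _ _
    · refine ae_of_all _ fun y ↦ ?_
      have h := (NNReal.tendsto_coe.2 (hlim y)).min (tendsto_const_nhds (x := (f₀ y : ℝ)))
      rwa [min_self] at h
  rw [tendsto_iff_norm_sub_tendsto_zero]
  have hbound : Tendsto (fun i ↦ 2 - 2 * ∫ y, min (f i y : ℝ) (f₀ y) ∂ν) l (𝓝 0) := by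
    simpa using (hmin.const_mul 2).const_sub 2
  refine squeeze_zero' (Eventually.of_forall fun i ↦ norm_nonneg _) ?_ hbound
  filter_upwards [hf] with i hi
  obtain ⟨hii, hi1⟩ := hint hi.1 hi.2
  have hadd : Integrable (fun y ↦ (f i y : ℝ) + f₀ y) ν := hii.add hi₀
  have hmi : Integrable (fun y ↦ min (f i y : ℝ) (f₀ y)) ν := hii.inf hi₀
  rw [hg' hi.1, hg' hf₀, ← integral_sub (hgint hii) (hgint hi₀)]
  calc ‖∫ y, ((f i y : ℝ) * g y - (f₀ y : ℝ) * g y) ∂ν‖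
      ≤ ∫ y, ((f i y : ℝ) + f₀ y - 2 * min (f i y : ℝ) (f₀ y)) ∂ν := by
        refine norm_integral_le_of_norm_le (hadd.sub (hmi.const_mul 2))
          (ae_of_all _ fun y ↦ ?_)
        have hid : (f i y : ℝ) + f₀ y - 2 * min (f i y : ℝ) (f₀ y) = |(f i y : ℝ) - f₀ y| := by
          rcases le_total (f i y : ℝ) (f₀ y) with h | h
          · rw [min_eq_left h, abs_of_nonpos (by linarith)]; ring
          · rw [min_eq_right h, abs_of_nonneg (by linarith)]; ring
        rw [hid, ← sub_mul, norm_mul]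
        exact mul_le_of_le_one_right (norm_nonneg _) (hg1 y)
    _ = 2 - 2 * ∫ y, min (f i y : ℝ) (f₀ y) ∂ν := by
        rw [integral_sub hadd (hmi.const_mul 2), integral_add hii hi₀,
          integral_const_mul, hi1, h1₀]
        norm_num

/-- The integral of a positive function with respect to a probability measure is positive. -/
lemma integral_pos_of_forall_pos {α : Type*} [MeasurableSpace α] {μ : Measure α}
    [IsProbabilityMeasure μ] {f : α → ℝ} (hf : Integrable f μ) (hpos : ∀ x, 0 < f x) :
    0 < ∫ x, f x ∂μ := by
  rw [integral_pos_iff_support_of_nonneg (fun x ↦ (hpos x).le) hf,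
    Function.support_eq_univ fun x ↦ (hpos x).ne']
  simp

end DensityLimits

namespace PrivateQMLE

/-! ### Smoothness from partial derivatives -/

section Smoothness

variable {d : ℕ}

/-- A function is of class `C²` if its partial derivatives are of class `C¹`. -/
lemma contDiffOn_two_of_pderiv {g : EuclideanSpace ℝ (Fin d) → ℝ}
    {U : Set (EuclideanSpace ℝ (Fin d))} (hU : IsOpen U) (hg : DifferentiableOn ℝ g U)
    (hp : ∀ j, ContDiffOn ℝ 1 (pderiv g j) U) : ContDiffOn ℝ 2 g U := by
  rw [show (2 : WithTop ℕ∞) = 1 + 1 by norm_num, contDiffOn_succ_iff_fderiv_of_isOpen hU]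
  -- In finite dimension it suffices to test the derivative on fixed vectors, where it is a
  -- combination of partial derivatives.
  refine ⟨hg, by simp, contDiffOn_clm_apply.2 fun y ↦ ?_⟩
  have hy : (fun β ↦ fderiv ℝ g β y) = fun β ↦ ∑ j, y j * pderiv g j β := by
    funext β
    conv_lhs => rw [← (EuclideanSpace.basisFun (Fin d) ℝ).sum_repr y]
    simp [pderiv]
  rw [hy]
  exact ContDiffOn.sum fun j _ ↦ contDiffOn_const.mul (hp j)

end Smoothness

/-! ### Bounds for the bit flip mechanisms -/

section Mechanisms

lemma one_lt_flipConst {η : ℝ} (hη : 0 < η) : 1 < flipConst η := by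
  have h : 0 < Real.exp η - 1 := by linarith [Real.add_one_lt_exp hη.ne']
  rw [flipConst, lt_div_iff₀ h]
  linarith

lemma trunc_mem_Icc {l u : ℝ} (h : l ≤ u) (v : ℝ) : trunc l u v ∈ Set.Icc l u :=
  ⟨le_max_left _ _, max_le h (min_le_right _ _)⟩

lemma bitFlip_false (η l u v : ℝ) : bitFlip η l u v false = 1 - bitFlip η l u v true := by
  simp only [bitFlip, if_true, Bool.false_eq_true, if_false]
  ring

/-- The input is within `(u - l) / 2` of the midpoint and `flipConst η > 1`, so the deviation from
`1 / 2` stays strictly below `1 / 2`. -/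
lemma bitFlip_mem_Ioo {η l u v : ℝ} (hη : 0 < η) (hlu : l < u) (hv : v ∈ Set.Icc l u) (z : Bool) :
    bitFlip η l u v z ∈ Set.Ioo (0 : ℝ) 1 := by
  have hC := one_lt_flipConst hη
  have hul : 0 < u - l := sub_pos.2 hlu
  have hden : 0 < (u - l) * flipConst η := mul_pos hul (by linarith)
  have habs : |(v - (u + l) / 2) / ((u - l) * flipConst η)| < 1 / 2 := by
    rw [abs_div, abs_of_pos hden, div_lt_iff₀ hden]
    have h1 : |v - (u + l) / 2| ≤ (u - l) / 2 := abs_le.2 ⟨by linarith [hv.1], by linarith [hv.2]⟩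
    have h2 : u - l < (u - l) * flipConst η := lt_mul_of_one_lt_right hul hC
    linarith
  rw [abs_lt] at habs
  cases z <;> simp only [bitFlip, if_true, Bool.false_eq_true, if_false, Set.mem_Ioo] <;>
    constructor <;> linarith [habs.1, habs.2]

lemma continuous_bitFlip_trunc (η l u : ℝ) (z : Bool) :
    Continuous fun v ↦ bitFlip η l u (trunc l u v) z := by
  cases z <;> simp only [bitFlip, trunc, if_true, Bool.false_eq_true, if_false] <;> fun_prop

variable {k : ℕ} (pr : Protocol)

lemma budget_pos (k : ℕ) : 0 < pr.ε / (k + 1) := div_pos pr.ε_pos (by positivity)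

lemma mechY_mem_Ioo (z : Bool) (y : ℝ) : mechY k pr z y ∈ Set.Ioo (0 : ℝ) 1 :=
  bitFlip_mem_Ioo (budget_pos pr k) pr.lY_lt_uY (trunc_mem_Icc pr.lY_lt_uY.le y) z

lemma mechY_false (y : ℝ) : mechY k pr false y = 1 - mechY k pr true y :=
  bitFlip_false _ _ _ _

lemma continuous_mechY (z : Bool) : Continuous (mechY k pr z) :=
  continuous_bitFlip_trunc _ _ _ z

lemma mechX_pos (z : Fin k → Bool) (x : EuclideanSpace ℝ (Fin k)) : 0 < mechX pr z x :=
  Finset.prod_pos fun j _ ↦ (bitFlip_mem_Ioo (budget_pos pr k) pr.lX_lt_uX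
    (trunc_mem_Icc pr.lX_lt_uX.le (x j)) (z j)).1

lemma mechX_le_one (z : Fin k → Bool) (x : EuclideanSpace ℝ (Fin k)) : mechX pr z x ≤ 1 := by
  have h (j : Fin k) := bitFlip_mem_Ioo (budget_pos pr k) pr.lX_lt_uX
    (trunc_mem_Icc pr.lX_lt_uX.le (x j)) (z j)
  exact Finset.prod_le_one (fun j _ ↦ (h j).1.le) fun j _ ↦ (h j).2.le

lemma continuous_mechX (z : Fin k → Bool) : Continuous (mechX pr z) :=
  continuous_finsetProd _ fun j _ ↦ (continuous_bitFlip_trunc _ _ _ (z j)).comp (by fun_prop)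

end Mechanisms

/-! ### Probabilities of the submitted bits -/

section Probabilities

variable {k : ℕ} {𝒳 : Set (EuclideanSpace ℝ (Fin k))} {𝒴 : Set ℝ} (pr : Protocol)

lemma integrable_mechY (Q : Measure 𝒴) [IsProbabilityMeasure Q] (z : Bool) :
    Integrable (fun y : 𝒴 ↦ mechY k pr z (y : ℝ)) Q :=
  Integrable.of_bound ((continuous_mechY pr z).comp continuous_subtype_val).aestronglyMeasurable 1
    (ae_of_all _ fun _ ↦ by
      rw [Real.norm_of_nonneg (mechY_mem_Ioo pr z _).1.le]
      exact (mechY_mem_Ioo pr z _).2.le)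

variable (G : Kernel 𝒳 𝒴)

lemma measurable_respProb : Measurable (respProb pr G) :=
  (StronglyMeasurable.integral_kernel
    ((continuous_mechY pr true).comp continuous_subtype_val).stronglyMeasurable).measurable

lemma obsProb_true_eq (Q : Measure 𝒳) (z : Fin k → Bool) :
    obsProb pr Q G (z, true) =
      ∫ x, respProb pr G x * mechX pr z (x : EuclideanSpace ℝ (Fin k)) ∂Q := by
  simp only [obsProb, respProb, mul_comm]

variable [IsMarkovKernel G]

lemma integral_mechY_false (x : 𝒳) :
    ∫ y, mechY k pr false (y : ℝ) ∂(G x) = 1 - respProb pr G x := by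
  simp_rw [mechY_false]
  rw [integral_sub (integrable_const _) (integrable_mechY pr (G x) true)]
  simp [respProb]

lemma respProb_mem_Ioo (x : 𝒳) : respProb pr G x ∈ Set.Ioo (0 : ℝ) 1 := by
  refine ⟨integral_pos_of_forall_pos (integrable_mechY pr (G x) true)
    fun y ↦ (mechY_mem_Ioo pr true _).1, ?_⟩
  rw [← sub_pos, ← integral_mechY_false]
  exact integral_pos_of_forall_pos (integrable_mechY pr (G x) false)
    fun y ↦ (mechY_mem_Ioo pr false _).1

variable (Q : Measure 𝒳) [IsProbabilityMeasure Q] (z : Fin k → Bool)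

lemma integrable_mechX : Integrable (fun x : 𝒳 ↦ mechX pr z (x : EuclideanSpace ℝ (Fin k))) Q :=
  Integrable.of_bound ((continuous_mechX pr z).comp continuous_subtype_val).aestronglyMeasurable 1
    (ae_of_all _ fun _ ↦ by
      rw [Real.norm_of_nonneg (mechX_pos pr z _).le]
      exact mechX_le_one pr z _)

lemma pHat_pos : 0 < pHat pr Q z :=
  integral_pos_of_forall_pos (integrable_mechX pr Q z) fun _ ↦ mechX_pos pr z _

lemma integrable_respProb_mul_mechX :
    Integrable (fun x ↦ respProb pr G x * mechX pr z (x : EuclideanSpace ℝ (Fin k))) Q :=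
  (integrable_mechX pr Q z).bdd_mul (measurable_respProb pr G).aestronglyMeasurable (c := 1)
    (ae_of_all _ fun x ↦ by
      rw [Real.norm_of_nonneg (respProb_mem_Ioo pr G x).1.le]
      exact (respProb_mem_Ioo pr G x).2.le)

lemma obsProb_false_eq :
    obsProb pr Q G (z, false) = pHat pr Q z -
      ∫ x, respProb pr G x * mechX pr z (x : EuclideanSpace ℝ (Fin k)) ∂Q := by
  rw [pHat, ← integral_sub (integrable_mechX pr Q z) (integrable_respProb_mul_mechX pr G Q z)]
  simp only [obsProb, integral_mechY_false]
  exact integral_congr_ae (ae_of_all _ fun _ ↦ by ring)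

end Probabilities

/-! ### Factorization and continuity of the likelihood -/

section Likelihood

variable {k d : ℕ} {𝒳 : Set (EuclideanSpace ℝ (Fin k))} {𝒴 : Set ℝ} (pr : Protocol)
  (Q : Measure 𝒳) [IsProbabilityMeasure Q] {Fmod : EuclideanSpace ℝ (Fin d) → Kernel 𝒳 𝒴}
  {β : EuclideanSpace ℝ (Fin d)}

/-- `Φ` is an average of response probabilities in `(0, 1)` with positive weights. Strictness keeps
both logarithms away from their singularity. -/
lemma Phi_mem_Ioo (hβ : IsMarkovKernel (Fmod β)) (z : Fin k → Bool) :
    Phi pr Q Fmod β z ∈ Set.Ioo (0 : ℝ) 1 := by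
  have hp := pHat_pos pr Q z
  have hint := integrable_respProb_mul_mechX pr (Fmod β) Q z
  refine ⟨div_pos (integral_pos_of_forall_pos hint fun x ↦
    mul_pos (respProb_mem_Ioo pr _ x).1 (mechX_pos pr z _)) hp, ?_⟩
  rw [Phi, div_lt_one hp, ← sub_pos, pHat, ← integral_sub (integrable_mechX pr Q z) hint]
  refine integral_pos_of_forall_pos ((integrable_mechX pr Q z).sub hint) fun x ↦ ?_
  rw [sub_pos]
  exact mul_lt_of_lt_one_left (mechX_pos pr z _) (respProb_mem_Ioo pr _ x).2

/-- The factorization of the log-likelihood of a single submission. -/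
lemma logModel_eq (hβ : IsMarkovKernel (Fmod β)) (z : Obs k) :
    logModel pr Q Fmod β z = Real.log (pHat pr Q z.1) +
      if z.2 then Real.log (Phi pr Q Fmod β z.1) else Real.log (1 - Phi pr Q Fmod β z.1) := by
  obtain ⟨zX, zY⟩ := z
  have hp := pHat_pos pr Q zX
  have hPhi := Phi_mem_Ioo pr Q hβ zX
  have hI : ∫ x, respProb pr (Fmod β) x * mechX pr zX (x : EuclideanSpace ℝ (Fin k)) ∂Q =
      pHat pr Q zX * Phi pr Q Fmod β zX := by
    rw [Phi, mul_div_cancel₀ _ hp.ne']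
  cases zY
  · rw [logModel, obsProb_false_eq, hI, ← mul_one_sub,
      Real.log_mul hp.ne' (sub_pos.2 hPhi.2).ne']
    simp
  · rw [logModel, obsProb_true_eq, hI, Real.log_mul hp.ne' hPhi.1.ne']
    simp

/-- `Φ` is continuous in the parameter when the model densities are. -/
lemma continuousOn_Phi {B : Set (EuclideanSpace ℝ (Fin d))} {ν : Measure 𝒴}
    (hMarkov : ∀ β ∈ B, IsMarkovKernel (Fmod β))
    {f : EuclideanSpace ℝ (Fin d) → 𝒳 → 𝒴 → ℝ≥0}
    (hf : ∀ β ∈ B, ∀ x, Measurable (f β x) ∧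
      Fmod β x = ν.withDensity fun y ↦ (f β x y : ℝ≥0∞))
    (hcont : ∀ x y, ContinuousOn (fun β ↦ f β x y) B) (z : Fin k → Bool) :
    ContinuousOn (fun β ↦ Phi pr Q Fmod β z) B := by
  -- Scheffé's lemma in `y` for fixed `x`; dominated convergence in `x`, with bound 1, follows.
  have hresp (x : 𝒳) : ContinuousOn (fun β ↦ respProb pr (Fmod β) x) B := by
    intro β₀ hβ₀
    have hprob {β : EuclideanSpace ℝ (Fin d)} (hβ : β ∈ B) :
        IsProbabilityMeasure (ν.withDensity fun y ↦ (f β x y : ℝ≥0∞)) := by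
      have := hMarkov β hβ
      rw [← (hf β hβ x).2]
      infer_instance
    have := hprob hβ₀
    have hlim := tendsto_integral_withDensity (l := 𝓝[B] β₀) (f := fun β ↦ f β x)
      (eventually_mem_nhdsWithin.mono fun β hβ ↦ ⟨(hf β hβ x).1, hprob hβ⟩) (hf β₀ hβ₀ x).1
      (fun y ↦ hcont x y β₀ hβ₀) (g := fun y : 𝒴 ↦ mechY k pr true (y : ℝ))
      ((continuous_mechY pr true).comp continuous_subtype_val).measurable fun y ↦ by
        rw [abs_of_pos (mechY_mem_Ioo pr true _).1]
        exact (mechY_mem_Ioo pr true _).2.le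
    rw [← (hf β₀ hβ₀ x).2] at hlim
    refine hlim.congr' (eventually_mem_nhdsWithin.mono fun β hβ ↦ ?_)
    simp only [respProb, (hf β hβ x).2]
  refine ContinuousOn.div_const (fun β₀ hβ₀ ↦ ?_) _
  refine continuousWithinAt_of_dominated (bound := fun _ ↦ 1) ?_ ?_ (integrable_const _) ?_
  · filter_upwards [eventually_mem_nhdsWithin] with β hβ
    have := hMarkov β hβ
    exact (integrable_respProb_mul_mechX pr (Fmod β) Q z).aestronglyMeasurable
  · filter_upwards [eventually_mem_nhdsWithin] with β hβ
    have := hMarkov β hβ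
    refine ae_of_all _ fun x ↦ ?_
    have hr := respProb_mem_Ioo pr (Fmod β) x
    have hx := mechX_pos pr z (x : EuclideanSpace ℝ (Fin k))
    rw [Real.norm_of_nonneg (mul_pos hr.1 hx).le]
    exact mul_le_one₀ hr.2.le hx.le (mechX_le_one pr z _)
  · exact ae_of_all _ fun x ↦ (hresp x β₀ hβ₀).mul continuousWithinAt_const

end Likelihood

end PrivateQMLE

/-! ### The privatized quasi-maximum likelihood estimator -/

theorem mainTheorem2 {k d : ℕ}
    -- the domains of the explanatory variables and of the response, and reference measures
    (𝒳 : Set (EuclideanSpace ℝ (Fin k))) (h𝒳 : MeasurableSet 𝒳)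
    (𝒴 : Set ℝ) (h𝒴 : MeasurableSet 𝒴)
    (μ : Measure 𝒳) (ν : Measure 𝒴)
    -- the protocol and the true distribution
    (pr : PrivateQMLE.Protocol)
    (FX : Measure 𝒳) [IsProbabilityMeasure FX]
    (F : Kernel 𝒳 𝒴) [IsMarkovKernel F]
    -- the provisional distribution and the model family, indexed by the compact set `B`
    (FXhat : Measure 𝒳) [IsProbabilityMeasure FXhat]
    (B : Set (EuclideanSpace ℝ (Fin d))) (hB : IsCompact B)
    (Fmod : EuclideanSpace ℝ (Fin d) → Kernel 𝒳 𝒴) (hFmod : ∀ β ∈ B, IsMarkovKernel (Fmod β))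
    -- `F(· | x)` has a measurable density
    (hF : ∃ f : 𝒳 → 𝒴 → ℝ≥0, ∀ x, Measurable (f x) ∧
      F x = ν.withDensity fun y ↦ (f x y : ℝ≥0∞))
    -- `F_X` has a measurable density
    (hFX : ∃ f : 𝒳 → ℝ≥0, Measurable f ∧ FX = μ.withDensity fun x ↦ (f x : ℝ≥0∞))
    -- `F̂_X` has a measurable density
    (hFXhat : ∃ f : 𝒳 → ℝ≥0, Measurable f ∧ FXhat = μ.withDensity fun x ↦ (f x : ℝ≥0∞))
    -- `F_β(· | x)` has a measurable density that is continuous in `β`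
    (hFmod_density : ∃ f : EuclideanSpace ℝ (Fin d) → 𝒳 → 𝒴 → ℝ≥0,
      (∀ β ∈ B, ∀ x, Measurable (f β x) ∧
        Fmod β x = ν.withDensity fun y ↦ (f β x y : ℝ≥0∞)) ∧
      ∀ x y, ContinuousOn (fun β ↦ f β x y) B)
    -- `β*` is the unique maximiser of `P log p_β` on `B`, and is interior to `B`
    (βs : EuclideanSpace ℝ (Fin d))
    (hβs : βs ∈ interior B)
    (hmax : ∀ β ∈ B, β ≠ βs →
      ∫ z, PrivateQMLE.logModel pr FXhat Fmod β z ∂(PrivateQMLE.obsLaw pr FX F) <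
        ∫ z, PrivateQMLE.logModel pr FXhat Fmod βs z ∂(PrivateQMLE.obsLaw pr FX F))
    -- `Φ'` exists and is continuously differentiable in `β`
    (hPhi_diff : ∀ zX : Fin k → Bool,
      DifferentiableOn ℝ (fun β ↦ PrivateQMLE.Phi pr FXhat Fmod β zX) (interior B) ∧
      ∀ j : Fin d, ContDiffOn ℝ 1
        (PrivateQMLE.pderiv (fun β ↦ PrivateQMLE.Phi pr FXhat Fmod β zX) j) (interior B))
    -- the entries of `Φ''` and of `Φ' Φ'ᵀ` are dominated by `P`-integrable functions
    (hPhi_dom : ∀ i j : Fin d, ∃ h : PrivateQMLE.Obs k → ℝ,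
      Integrable h (PrivateQMLE.obsLaw pr FX F) ∧
      ∀ β ∈ interior B, ∀ z : PrivateQMLE.Obs k,
        |PrivateQMLE.hess (fun b ↦ PrivateQMLE.Phi pr FXhat Fmod b z.1) β i j| ≤ h z ∧
        |PrivateQMLE.gradOuter (fun b ↦ PrivateQMLE.Phi pr FXhat Fmod b z.1) β i j| ≤ h z)
    -- `E[Φ' Φ'ᵀ]` is nonsingular at `β*`
    (hPhi_reg : IsUnit (PrivateQMLE.expMatrix (PrivateQMLE.obsLaw pr FX F) fun z ↦
      PrivateQMLE.gradOuter (fun b ↦ PrivateQMLE.Phi pr FXhat Fmod b z.1) βs).det)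
    -- `A(β*)` is nonsingular
    (hA : IsUnit (PrivateQMLE.matA pr (PrivateQMLE.obsLaw pr FX F) FXhat Fmod βs).det)
    -- the submissions of the users are independent with the law that the protocol produces
    {Ω : Type*} [MeasurableSpace Ω] (Pr : Measure Ω) [IsProbabilityMeasure Pr]
    (Z : ℕ → Ω → PrivateQMLE.Obs k)
    (hZ_indep : iIndepFun Z Pr)
    (hZ_law : ∀ i, HasLaw (Z i) (PrivateQMLE.obsLaw pr FX F) Pr)
    -- `β̂_n` is a random variable that maximises the likelihood of the first `n` submissions
    (βhat : ℕ → Ω → EuclideanSpace ℝ (Fin d))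
    (hβhat_meas : ∀ n, AEMeasurable (βhat n) Pr)
    (hβhat : ∀ n ω, βhat n ω ∈ B ∧
      IsMaxOn (PrivateQMLE.logLik pr FXhat Fmod fun i : Fin n ↦ Z i ω) B (βhat n ω)) :
    TendstoInDistribution
      (fun (n : ℕ) (ω : Ω) ↦ Real.sqrt n • (βhat n ω - βs)) atTop
      (id : EuclideanSpace ℝ (Fin d) → EuclideanSpace ℝ (Fin d)) (fun _ ↦ Pr)
      (multivariateGaussian 0
        ((PrivateQMLE.matA pr (PrivateQMLE.obsLaw pr FX F) FXhat Fmod βs)⁻¹ *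
          PrivateQMLE.matB pr (PrivateQMLE.obsLaw pr FX F) FXhat Fmod βs *
          (PrivateQMLE.matA pr (PrivateQMLE.obsLaw pr FX F) FXhat Fmod βs)⁻¹)) := by
    classical
  have hlog {β : EuclideanSpace ℝ (Fin d)} (hβ : β ∈ B) :=
    PrivateQMLE.logModel_eq pr FXhat (hFmod β hβ)
  have hPhi {β : EuclideanSpace ℝ (Fin d)} (hβ : β ∈ B) :=
    PrivateQMLE.Phi_mem_Ioo pr FXhat (hFmod β hβ)
  obtain ⟨f, hf, hfcont⟩ := hFmod_density
  refine tendstoInDistribution_mEstimator (m := PrivateQMLE.logModel pr FXhat Fmod) hB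
    (fun z ↦ ?_) hβs hmax (fun z ↦ ?_) hA hZ_indep hZ_law hβhat_meas
    fun n ω ↦ ⟨(hβhat n ω).1, fun β hβ ↦ ?_⟩
  · have hc := PrivateQMLE.continuousOn_Phi pr FXhat hFmod hf hfcont z.1
    refine ContinuousOn.congr ?_ fun β hβ ↦ hlog hβ z
    split_ifs
    · exact continuousOn_const.add (hc.log fun β hβ ↦ (hPhi hβ z.1).1.ne')
    · exact continuousOn_const.add
        ((continuousOn_const.sub hc).log fun β hβ ↦ (sub_pos.2 (hPhi hβ z.1).2).ne')
  · have hs := (PrivateQMLE.contDiffOn_two_of_pderiv isOpen_interior (hPhi_diff z.1).1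
      (hPhi_diff z.1).2).contDiffAt (isOpen_interior.mem_nhds hβs)
    have hP := hPhi (interior_subset hβs) z.1
    -- The factorization is available only for `β ∈ B`, where the model kernel is Markov; as `βs` is
    -- interior, this covers a neighbourhood.
    refine ContDiffAt.congr_of_eventuallyEq ?_
      (eventually_of_mem (mem_interior_iff_mem_nhds.1 hβs) fun β hβ ↦ hlog hβ z)
    split_ifs
    · exact contDiffAt_const.add (hs.log hP.1.ne')
    · exact contDiffAt_const.add ((contDiffAt_const.sub hs).log (sub_pos.2 hP.2).ne')
  · have hlik {b : EuclideanSpace ℝ (Fin d)} (hb : b ∈ B) :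
        (n : ℝ)⁻¹ * ∑ i ∈ Finset.range n, PrivateQMLE.logModel pr FXhat Fmod b (Z i ω) =
          PrivateQMLE.logLik pr FXhat Fmod (fun i : Fin n ↦ Z i ω) b := by
      simp only [PrivateQMLE.logLik, hlog hb, one_div]
      rw [Finset.sum_range]
    have h := (hβhat n ω).2 hβ
    simp only [Set.mem_ofPred_eq] at h ⊢
    rwa [hlik hβ, hlik (hβhat n ω).1]
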